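/- Let $n\ge 2$ be a natural number. For distinct $i,j<n$ let $[i|j]\colon n\to n$ be the replacement that sends $i$ to $j$ and fixes everything else, and let $[i,j]$ be the transposition of $i$ and $j$. Consider (nonempty) algebras of the similarity type $\{\cdot,-,s^i_j,s_{ij}\}_{i\ne j<n}$, where $\cdot$ is binary and all other operations are unary; $a+b$ abbreviates $-(-a\cdot -b)$, $0$ abbreviates $x\cdot -x$ and $1$ abbreviates $x+ -x$. For a set $U$, the full substitution set algebra with transpositions with base $U$ is $\langle\mathcal P({}^nU);\cap,\sim,S^i_j,S_{ij}\rangle_{i\neq j<n}$, where $S^i_j(X)=\{q\in{}^nU: q\circ[i|j]\in X\}$ and $S_{ij}(X)=\{q\in{}^nU: q\circ[i,j]\in X\}$. Let $SetSA_n$ be the class of (isomorphic copies of) subalgebras of such algebras, and let $RSA_n=\mathbf{SP}\,SetSA_n$. Let $\Sigma_n$ consist of the following equations, for all indices $i,j,k,l<n$ such that those occurring in the equation are distinct: (1) the Boolean axioms (a finite equational basis for Boolean algebras in terms of $\cdot$ and $-$); (2) each $s_{ij}$ and each $s^i_j$ preserves $\cdot$, $+$, $0$ and $1$; (3) $s_{ij}x=s_{ji}x$,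 $\;s_{ij}s_{ij}x=x$, $\;s_{ij}s_{jk}s_{ij}x=s_{ik}x$, $\;s_{ij}s_{kl}x=s_{kl}s_{ij}x$; (4) $s_{kl}s^j_is_{kl}x=s^j_ix$, $\;s_{jk}s^j_is_{jk}x=s^k_ix$, $\;s_{ki}s^j_is_{ki}x=s^j_kx$, $\;s_{ij}s^j_is_{ij}x=s^i_jx$; (5) $s^j_is^k_lx=s^k_ls^j_ix$, $\;s^j_is^k_ix=s^k_is^j_ix=s^j_is^k_jx$, $\;s^j_is^i_kx=s^j_ks_{ij}x$, $\;s^j_is^j_kx=s^j_kx$, $\;s^j_is^j_ix=s^j_ix$, $\;s^j_is^i_jx=s^j_ix$, $\;s^j_is_{ij}x=s^j_ix$. Let $SA_n=\mathbf{Mod}(\Sigma_n)$. Then: (a) $\Sigma_n$ is finite, and its equations (2)--(5) are positive, that is, both sides are built from variables, $0$ and $1$ using only $\cdot$, $+$ and the substitution operations. (b) The relations between words given by (3)--(5) form a presentation of the monoid ${}^nn$ of all self-maps of $n$ under composition, with generators $s^i_j\mapsto[i|j]$ and $s_{ij}\mapsto[i,j]$: these maps generate ${}^nn$, and two words in the generators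 have the same value in ${}^nn$ if and only if they are congruent modulo the relations. (c) $RSA_n=SA_n$. (d) Consequently $RSA_n$ is a variety (closed under homomorphic images, subalgebras and direct products) that is axiomatized by a finite set of equations. -/

import Mathlib

open scoped FirstOrder

universe u

namespace SubstAlg

/-! ### Transpositions and replacements in the monoid of self-maps of `n` -/

/-- The names of the substitution operations: `repl i j` is the name `s^i_j` of the replacement
`[i|j]`, and `transp i j` is the name `s_{ij}` of the transposition `[i,j]` (`i ≠ j`). -/
inductive Gen (n : ℕ) : Type
  | repl (i j : Fin n) (h : i ≠ j) : Gen n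
  | transp (i j : Fin n) (h : i ≠ j) : Gen n

/-- The self-map of `n` named by a generator: `[i|j]` sends `i` to `j` and fixes everything else,
`[i,j]` swaps `i` and `j`. -/
def Gen.toFun {n : ℕ} : Gen n → Fin n → Fin n
  | .repl i j _ => Function.update id i j
  | .transp i j _ => Equiv.swap i j

/-- The same self-map, as an element of the monoid of self-maps under composition. -/
def Gen.toEnd {n : ℕ} (g : Gen n) : Function.End (Fin n) := g.toFun

/-- The value `t̂` of a word `t` in the monoid of self-maps of `n` under composition: the empty word
goes to the identity, and `(g t)^ = g ∘ t^` for a generator `g`. -/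
def wordMap (n : ℕ) : FreeMonoid (Gen n) →* Function.End (Fin n) :=
  FreeMonoid.lift Gen.toEnd

/-- The one-letter word `s^i_j`. -/
def r {n : ℕ} (i j : Fin n) (h : i ≠ j) : FreeMonoid (Gen n) := FreeMonoid.of (.repl i j h)

/-- The one-letter word `s_{ij}`. -/
def t {n : ℕ} (i j : Fin n) (h : i ≠ j) : FreeMonoid (Gen n) := FreeMonoid.of (.transp i j h)

/-- The defining relations; all indices occurring in one relation are distinct. -/
inductive Rel (n : ℕ) : FreeMonoid (Gen n) → FreeMonoid (Gen n) → Prop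
  /-- `s_ij = s_ji` -/
  | transp_symm (i j : Fin n) (hij : i ≠ j) : Rel n (t i j hij) (t j i hij.symm)
  /-- `s_ij s_ij = 1` -/
  | transp_sq (i j : Fin n) (hij : i ≠ j) : Rel n (t i j hij * t i j hij) 1
  /-- `s_ij s_jk s_ij = s_ik` -/
  | transp_conj (i j k : Fin n) (hij : i ≠ j) (hik : i ≠ k) (hjk : j ≠ k) :
      Rel n (t i j hij * t j k hjk * t i j hij) (t i k hik)
  /-- `s_ij s_kl = s_kl s_ij` -/
  | transp_comm (i j k l : Fin n) (hij : i ≠ j) (hik : i ≠ k) (hil : i ≠ l) (hjk : j ≠ k)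
      (hjl : j ≠ l) (hkl : k ≠ l) :
      Rel n (t i j hij * t k l hkl) (t k l hkl * t i j hij)
  /-- `s_kl s^j_i s_kl = s^j_i` -/
  | conj_kl (i j k l : Fin n) (hij : i ≠ j) (hik : i ≠ k) (hil : i ≠ l) (hjk : j ≠ k)
      (hjl : j ≠ l) (hkl : k ≠ l) :
      Rel n (t k l hkl * r j i hij.symm * t k l hkl) (r j i hij.symm)
  /-- `s_jk s^j_i s_jk = s^k_i` -/
  | conj_jk (i j k : Fin n) (hij : i ≠ j) (hik : i ≠ k) (hjk : j ≠ k) :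
      Rel n (t j k hjk * r j i hij.symm * t j k hjk) (r k i hik.symm)
  /-- `s_ki s^j_i s_ki = s^j_k` -/
  | conj_ki (i j k : Fin n) (hij : i ≠ j) (hik : i ≠ k) (hjk : j ≠ k) :
      Rel n (t k i hik.symm * r j i hij.symm * t k i hik.symm) (r j k hjk)
  /-- `s_ij s^j_i s_ij = s^i_j` -/
  | conj_ij (i j : Fin n) (hij : i ≠ j) :
      Rel n (t i j hij * r j i hij.symm * t i j hij) (r i j hij)
  /-- `s^j_i s^k_l = s^k_l s^j_i` -/
  | repl_comm (i j k l : Fin n) (hij : i ≠ j) (hik : i ≠ k) (hil : i ≠ l) (hjk : j ≠ k)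
      (hjl : j ≠ l) (hkl : k ≠ l) :
      Rel n (r j i hij.symm * r k l hkl) (r k l hkl * r j i hij.symm)
  /-- `s^j_i s^k_i = s^k_i s^j_i` -/
  | repl_same (i j k : Fin n) (hij : i ≠ j) (hik : i ≠ k) (hjk : j ≠ k) :
      Rel n (r j i hij.symm * r k i hik.symm) (r k i hik.symm * r j i hij.symm)
  /-- `s^k_i s^j_i = s^j_i s^k_j` -/
  | repl_same_chain (i j k : Fin n) (hij : i ≠ j) (hik : i ≠ k) (hjk : j ≠ k) :
      Rel n (r k i hik.symm * r j i hij.symm) (r j i hij.symm * r k j hjk.symm)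
  /-- `s^j_i s^i_k = s^j_k s_ij` -/
  | repl_chain (i j k : Fin n) (hij : i ≠ j) (hik : i ≠ k) (hjk : j ≠ k) :
      Rel n (r j i hij.symm * r i k hik) (r j k hjk * t i j hij)
  /-- `s^j_i s^j_k = s^j_k` -/
  | repl_absorb (i j k : Fin n) (hij : i ≠ j) (hik : i ≠ k) (hjk : j ≠ k) :
      Rel n (r j i hij.symm * r j k hjk) (r j k hjk)
  /-- `s^j_i s^j_i = s^j_i` -/
  | repl_idem (i j : Fin n) (hij : i ≠ j) :
      Rel n (r j i hij.symm * r j i hij.symm) (r j i hij.symm)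
  /-- `s^j_i s^i_j = s^j_i` -/
  | repl_back (i j : Fin n) (hij : i ≠ j) :
      Rel n (r j i hij.symm * r i j hij) (r j i hij.symm)
  /-- `s^j_i s_ij = s^j_i` -/
  | repl_transp (i j : Fin n) (hij : i ≠ j) :
      Rel n (r j i hij.symm * t i j hij) (r j i hij.symm)

/-- `R` is a presentation of the monoid of all self-maps of `n` by the generators `[i|j]`, `[i,j]`:
every self-map is the value of a word, and two words have the same value iff they are congruent
modulo `R`. -/
def IsPresentation (n : ℕ) (R : FreeMonoid (Gen n) → FreeMonoid (Gen n) → Prop) : Prop :=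
  Function.Surjective (wordMap n) ∧
    ∀ w₁ w₂ : FreeMonoid (Gen n), conGen R w₁ w₂ ↔ wordMap n w₁ = wordMap n w₂

/-! ### The similarity type, algebras, terms and equations -/

/-- The operation symbols: meet, complement, and one unary symbol for each generator. -/
inductive Op (n : ℕ) : ℕ → Type
  | meet : Op n 2
  | compl : Op n 1
  | subst (g : Gen n) : Op n 1

/-- The similarity type `{·, -, s^i_j, s_{ij}}`, with `i ≠ j` in `n`. -/
def lang (n : ℕ) : FirstOrder.Language.{0, 0} := ⟨Op n, fun _ => Empty⟩

/-- An algebra of this similarity type (nonempty, as usual). -/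
structure Alg (n : ℕ) : Type (u + 1) where
  carrier : Type u
  [str : (lang n).Structure carrier]
  [nonempty : Nonempty carrier]

attribute [instance] Alg.str Alg.nonempty

/-- Terms in the variables `x₀, x₁, …`. -/
abbrev Tm (n : ℕ) : Type := (lang n).Term ℕ

/-- Equations, as pairs of terms. -/
abbrev Eqn (n : ℕ) : Type := Tm n × Tm n

/-- The variable `x_i`. -/
def x {n : ℕ} (i : ℕ) : Tm n := FirstOrder.Language.Term.var i

/-- The term `a · b`. -/
def tMeet {n : ℕ} (a b : Tm n) : Tm n :=
  FirstOrder.Language.Term.func (L := lang n) (Op.meet : Op n 2) ![a, b]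

/-- The term `-a`. -/
def tCompl {n : ℕ} (a : Tm n) : Tm n :=
  FirstOrder.Language.Term.func (L := lang n) (Op.compl : Op n 1) ![a]

/-- The term `s a`, for a substitution symbol `s`. -/
def tSubst {n : ℕ} (g : Gen n) (a : Tm n) : Tm n :=
  FirstOrder.Language.Term.func (L := lang n) (Op.subst g : Op n 1) ![a]

/-- `a + b` abbreviates `-(-a · -b)`. -/
def tJoin {n : ℕ} (a b : Tm n) : Tm n := tCompl (tMeet (tCompl a) (tCompl b))

/-- `0` abbreviates `x₀ · -x₀`. -/
def tZero {n : ℕ} : Tm n := tMeet (x 0) (tCompl (x 0))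

/-- `1` abbreviates `x₀ + -x₀`. -/
def tOne {n : ℕ} : Tm n := tJoin (x 0) (tCompl (x 0))

/-- The term `s_1 s_2 ⋯ s_m a` for a word `s_1 s_2 ⋯ s_m`. -/
def tWord {n : ℕ} (w : FreeMonoid (Gen n)) (a : Tm n) : Tm n := w.toList.foldr tSubst a

/-- Positive terms: built from variables, `0` and `1` by meets, joins and substitutions. -/
inductive Positive {n : ℕ} : Tm n → Prop
  | var (i : ℕ) : Positive (x i)
  | zero : Positive tZero
  | one : Positive tOne
  | meet {a b : Tm n} : Positive a → Positive b → Positive (tMeet a b)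
  | join {a b : Tm n} : Positive a → Positive b → Positive (tJoin a b)
  | subst (g : Gen n) {a : Tm n} : Positive a → Positive (tSubst g a)

/-- `A ⊨ a = b`. -/
def Alg.Satisfies {n : ℕ} (A : Alg.{u} n) (e : Eqn n) : Prop :=
  ∀ v : ℕ → A.carrier, e.1.realize v = e.2.realize v

/-- `Mod(E)`, the class of all models of a set of equations. -/
def Mod {n : ℕ} (E : Set (Eqn n)) : Set (Alg.{u} n) := {A | ∀ e ∈ E, A.Satisfies e}

/-! ### Class operators and varieties -/

/-- The direct product of a family of algebras. -/
def prodAlg {n : ℕ} {I : Type u} (F : I → Alg.{u} n) : Alg.{u} n where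
  carrier := ∀ i, (F i).carrier
  str :=
    { funMap := fun f a i => FirstOrder.Language.Structure.funMap f (fun k => a k i)
      RelMap := fun r _ => nomatch r }

/-- `H K`: the homomorphic images of members of `K`. -/
def H {n : ℕ} (K : Set (Alg.{u} n)) : Set (Alg.{u} n) :=
  {A | ∃ B ∈ K, ∃ f : B.carrier →[lang n] A.carrier, Function.Surjective f}

/-- `S K`: the algebras isomorphic to a subalgebra of a member of `K`. -/
def S {n : ℕ} (K : Set (Alg.{u} n)) : Set (Alg.{u} n) :=
  {A | ∃ B ∈ K, Nonempty (A.carrier ↪[lang n] B.carrier)}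

/-- `P K`: the algebras isomorphic to a direct product of a family of members of `K`. -/
def P {n : ℕ} (K : Set (Alg.{u} n)) : Set (Alg.{u} n) :=
  {A | ∃ (I : Type u) (F : I → Alg.{u} n), (∀ i, F i ∈ K) ∧
    Nonempty (A.carrier ≃[lang n] (prodAlg F).carrier)}

/-- A variety: a class closed under homomorphic images, subalgebras and direct products. -/
def IsVariety {n : ℕ} (K : Set (Alg.{u} n)) : Prop := H K ⊆ K ∧ S K ⊆ K ∧ P K ⊆ K

/-- `K` is axiomatized by a finite set of equations. -/
def IsFinitelyBased {n : ℕ} (K : Set (Alg.{u} n)) : Prop :=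
  ∃ E : Set (Eqn n), E.Finite ∧ K = Mod E

/-! ### Set algebras -/

/-- The full substitution set algebra with transpositions of dimension `n` with base `U`: the
subsets of `ⁿU` with intersection, complement and `S_τ X = {q | q ∘ τ ∈ X}` for `τ = [i|j]` and
`τ = [i,j]`. -/
def fullAlg (n : ℕ) (U : Type u) : Alg.{u} n where
  carrier := Set (Fin n → U)
  str :=
    { funMap := fun {_} f => match f with
        | Op.meet => fun X => X 0 ∩ X 1
        | Op.compl => fun X => (X 0)ᶜ
        | Op.subst g => fun X => {q | q ∘ g.toFun ∈ X 0}
      RelMap := fun r _ => nomatch r }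
  nonempty := ⟨(∅ : Set (Fin n → U))⟩

/-- `SetSA_n`, the class of subalgebras of full set algebras. -/
def SetSA (n : ℕ) : Set (Alg.{u} n) := S {A | ∃ U : Type u, A = fullAlg n U}

/-- `RSA_n = SP SetSA_n`. -/
def RSA (n : ℕ) : Set (Alg.{u} n) := S (P (SetSA n))

/-! ### The axioms -/

/-- The Boolean axioms. -/
def booleanAxioms (n : ℕ) : Set (Eqn n) :=
  { (tMeet (x 0) (x 1), tMeet (x 1) (x 0)),
    (tJoin (x 0) (x 1), tJoin (x 1) (x 0)),
    (tMeet (tMeet (x 0) (x 1)) (x 2), tMeet (x 0) (tMeet (x 1) (x 2))),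
    (tJoin (tJoin (x 0) (x 1)) (x 2), tJoin (x 0) (tJoin (x 1) (x 2))),
    (tMeet (x 0) (tJoin (x 0) (x 1)), x 0),
    (tJoin (x 0) (tMeet (x 0) (x 1)), x 0),
    (tMeet (x 0) (tJoin (x 1) (x 2)), tJoin (tMeet (x 0) (x 1)) (tMeet (x 0) (x 2))),
    (tJoin (x 0) (tMeet (x 1) (x 2)), tMeet (tJoin (x 0) (x 1)) (tJoin (x 0) (x 2))),
    (tJoin (x 1) tZero, x 1),
    (tMeet (x 1) tOne, x 1) }

/-- The substitutions preserve meets, joins, `0` and `1`. -/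
def endoAxioms (n : ℕ) : Set (Eqn n) :=
  {e | ∃ g : Gen n,
    e = (tSubst g (tMeet (x 0) (x 1)), tMeet (tSubst g (x 0)) (tSubst g (x 1))) ∨
    e = (tSubst g (tJoin (x 0) (x 1)), tJoin (tSubst g (x 0)) (tSubst g (x 1))) ∨
    e = (tSubst g tZero, tZero) ∨
    e = (tSubst g tOne, tOne)}

/-- A relation `w₁ = w₂` between words is encoded by the equation `w₁ x₀ = w₂ x₀`. -/
def relAxioms {n : ℕ} (R : FreeMonoid (Gen n) → FreeMonoid (Gen n) → Prop) : Set (Eqn n) :=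
  {e | ∃ w₁ w₂, R w₁ w₂ ∧ e = (tWord w₁ (x 0), tWord w₂ (x 0))}

/-- The axiom system `Σ_n`. -/
def Ax (n : ℕ) : Set (Eqn n) := booleanAxioms n ∪ endoAxioms n ∪ relAxioms (Rel n)

/-- `SA_n = Mod(Σ_n)`. -/
def SA (n : ℕ) : Set (Alg.{u} n) := Mod (Ax n)

end SubstAlg

/-!
A self-map of a finite linearly ordered set factors as `σ ∘ m` with a permutation `σ` and the
idempotent map `m` that sends every element to the least element with the same value; `m` is
determined by the kernel, and `σ` up to a permutation of the points outside the range of `m`. Let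
`M` be a monoid with elements `T i j`, `R i j` that satisfy the relations. The relations between
the `T i j` alone hold in no larger group than the symmetric group (coset enumeration), hence `σ`
has a value in `M`; the value of `m` is the product of the pairwise commuting elements
`R i (m i)`. The product of the two values does not depend on the factorization and is compatible
with multiplication by generators. So the submonoid of `ⁿn × M` generated by the pairs of
corresponding generators is the graph of a homomorphism, and `ⁿn` has the universal property of
the presented monoid.

Consequently the models of `Σ_n` are the Boolean algebras on which `ⁿn` acts by endomorphisms. For
such an action `ρ` and a prime filter `F`, `b ↦ {q | ρ q b ∈ F}` is a homomorphism into the full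
set algebra with base `n`. The identity map lies in the image of `b` exactly when `b ∈ F`, so these
homomorphisms separate points.
-/

namespace SubstAlg

lemma exists_monoidHom_of_existsUnique {M N : Type*} [Monoid M] [Monoid N]
    {G : Submonoid (M × N)} (hG : ∀ a, ∃! b, (a, b) ∈ G) :
    ∃ φ : M →* N, ∀ a b, (a, b) ∈ G ↔ φ a = b := by
  have bijective : Function.Bijective (Prod.fst ∘ G.subtype) := by
    refine ⟨?_, fun a => ?_⟩
    · rintro ⟨⟨a, b⟩, hb⟩ ⟨⟨_, b'⟩, hb'⟩ rfl
      exact Subtype.ext (Prod.ext rfl ((hG a).unique hb hb'))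
    · obtain ⟨b, hb, -⟩ := hG a
      exact ⟨⟨(a, b), hb⟩, rfl⟩
  obtain ⟨φ, rfl⟩ := Submonoid.exists_eq_mgraph bijective
  exact ⟨φ, fun a b => MonoidHom.mem_mgraph⟩

/-! ### Symmetric groups -/

section TranspositionSystems

variable {α M N : Type*} [DecidableEq α] [Monoid M] [Monoid N]

/-- A family `T i j` of elements of a monoid that satisfies the relations between transpositions,
where `T i i = 1`. The conjugation law unites the paper's relations for the various coincidences
among the indices. -/
structure IsTranspositionSystem (T : α → α → M) : Prop where
  self (i : α) : T i i = 1
  mul_self (i j : α) : T i j * T i j = 1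
  conj (a b c d : α) : T a b * T c d * T a b = T (Equiv.swap a b c) (Equiv.swap a b d)

lemma isTranspositionSystem_swap :
    IsTranspositionSystem (Equiv.swap : α → α → Equiv.Perm α) where
  self := Equiv.swap_self
  mul_self := Equiv.swap_mul_self
  conj a b c d := by rw [Equiv.swap_apply_apply, Equiv.swap_inv]

/-- The submonoid generated by the transpositions of elements of `s`. -/
def transpositions (T : α → α → M) (s : Finset α) : Submonoid M :=
  Submonoid.closure {p | ∃ i ∈ s, ∃ j ∈ s, p = T i j}

omit [DecidableEq α] in
lemma mem_transpositions (T : α → α → M) {s : Finset α} {i j : α} (hi : i ∈ s) (hj : j ∈ s) :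
    T i j ∈ transpositions T s :=
  Submonoid.subset_closure ⟨i, hi, j, hj, rfl⟩

lemma fst_apply_of_mem_transpositions {T : α → α → M} {s : Finset α} {p : Equiv.Perm α × M}
    (hp : p ∈ transpositions (fun i j => (Equiv.swap i j, T i j)) s) {a : α} (ha : a ∉ s) :
    p.1 a = a := by
  induction hp using Submonoid.closure_induction with
  | mem p hp =>
    obtain ⟨i, hi, j, hj, rfl⟩ := hp
    exact Equiv.swap_apply_of_ne_of_ne (ne_of_mem_of_not_mem hi ha).symm
      (ne_of_mem_of_not_mem hj ha).symm
  | one => rfl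
  | mul p q _ _ ihp ihq => rw [Prod.fst_mul, Equiv.Perm.mul_apply, ihq, ihp]

namespace IsTranspositionSystem

variable {T : α → α → M}

lemma prod {T' : α → α → N} (h : IsTranspositionSystem T) (h' : IsTranspositionSystem T') :
    IsTranspositionSystem fun i j => (T i j, T' i j) where
  self i := Prod.ext (h.self i) (h'.self i)
  mul_self i j := Prod.ext (h.mul_self i j) (h'.mul_self i j)
  conj a b c d := Prod.ext (h.conj a b c d) (h'.conj a b c d)

variable (h : IsTranspositionSystem T)
include h

lemma symm (i j : α) : T i j = T j i := by
  simpa [h.mul_self] using h.conj i j i j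

lemma mul_eq_conj_mul (a b c d : α) :
    T a b * T c d = T (Equiv.swap a b c) (Equiv.swap a b d) * T a b := by
  rw [← h.conj, mul_assoc _ (T a b), h.mul_self, mul_one]

lemma exists_mul_mul_eq_of_mem_insert {s : Finset α} {a b d : α} (hb : b ∈ insert a s)
    (hd : d ∈ insert a s) :
    ∃ b' ∈ insert a s, ∃ q ∈ transpositions T s, T a d * T a b = T a b' * q := by
  by_cases hda : d = a
  · exact ⟨b, hb, 1, one_mem _, by rw [hda, h.self, one_mul, mul_one]⟩
  by_cases hba : b = a
  · exact ⟨d, hd, 1, one_mem _, by rw [hba, h.self]⟩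
  by_cases hdb : d = b
  · exact ⟨a, Finset.mem_insert_self a s, 1, one_mem _, by rw [hdb, h.mul_self, h.self, one_mul]⟩
  · refine ⟨b, hb, T b d, mem_transpositions T (Finset.mem_of_mem_insert_of_ne hb hba)
      (Finset.mem_of_mem_insert_of_ne hd hda), ?_⟩
    rw [h.mul_eq_conj_mul a b b d, Equiv.swap_apply_right, Equiv.swap_apply_of_ne_of_ne hda hdb]

lemma exists_mul_of_mem_transpositions_insert {s : Finset α} {a : α} {p : M}
    (hp : p ∈ transpositions T (insert a s)) :
    ∃ b ∈ insert a s, ∃ q ∈ transpositions T s, p = T a b * q := by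
  induction hp using Submonoid.closure_induction_left with
  | one => exact ⟨a, Finset.mem_insert_self a s, 1, one_mem _, by rw [h.self, one_mul]⟩
  | mul_left w hw p _ ih =>
    obtain ⟨b, hb, q, hq, rfl⟩ := ih
    have mul_coset (d : α) (hd : d ∈ insert a s) : ∃ b' ∈ insert a s, ∃ q' ∈ transpositions T s,
        T a d * (T a b * q) = T a b' * q' := by
      obtain ⟨b', hb', q', hq', e⟩ := h.exists_mul_mul_eq_of_mem_insert hb hd
      exact ⟨b', hb', q' * q, mul_mem hq' hq, by rw [← mul_assoc, e, mul_assoc]⟩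
    obtain ⟨c, hc, d, hd, rfl⟩ := hw
    by_cases hca : c = a
    · rw [hca]
      exact mul_coset d hd
    by_cases hda : d = a
    · rw [hda, h.symm c a]
      exact mul_coset c hc
    have hT : T c d ∈ transpositions T s := mem_transpositions T
      (Finset.mem_of_mem_insert_of_ne hc hca) (Finset.mem_of_mem_insert_of_ne hd hda)
    refine ⟨Equiv.swap c d b, ?_, T c d * q, mul_mem hT hq, ?_⟩
    · rw [Equiv.swap_apply_def]
      split_ifs <;> assumption
    · rw [← mul_assoc, h.mul_eq_conj_mul,
        Equiv.swap_apply_of_ne_of_ne (Ne.symm hca) (Ne.symm hda), mul_assoc]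

lemma snd_eq_one_of_fst_eq_one (s : Finset α) {p : Equiv.Perm α × M}
    (hp : p ∈ transpositions (fun i j => (Equiv.swap i j, T i j)) s) (h₁ : p.1 = 1) :
    p.2 = 1 := by
  induction s using Finset.induction_on generalizing p with
  | empty =>
    have : p = 1 := by simpa [transpositions] using hp
    rw [this, Prod.snd_one]
  | insert a s ha ih =>
    obtain ⟨b, -, q, hq, rfl⟩ :=
      (isTranspositionSystem_swap.prod h).exists_mul_of_mem_transpositions_insert hp
    have hab : b = a := by
      simpa [fst_apply_of_mem_transpositions hq ha] using Equiv.congr_fun h₁ a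
    subst hab
    have hq₁ : q.1 = 1 := by simpa [← Equiv.Perm.one_def] using h₁
    rw [Prod.snd_mul, h.self, one_mul, ih hq hq₁]

theorem exists_monoidHom [Finite α] :
    ∃ φ : Equiv.Perm α →* M, ∀ i j, φ (Equiv.swap i j) = T i j := by
  cases nonempty_fintype α
  let G := transpositions (fun i j => (Equiv.swap i j, T i j)) (Finset.univ : Finset α)
  have swap_mem (i j : α) : (Equiv.swap i j, T i j) ∈ G :=
    mem_transpositions _ (Finset.mem_univ i) (Finset.mem_univ j)
  have exists_mem (σ : Equiv.Perm α) : ∃ m, (σ, m) ∈ G := by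
    induction σ using Equiv.Perm.swap_induction_on with
    | one => exact ⟨1, one_mem G⟩
    | swap_mul σ i j _ ih =>
      obtain ⟨m, hm⟩ := ih
      exact ⟨T i j * m, mul_mem (swap_mem i j) hm⟩
  have existsUnique (σ : Equiv.Perm α) : ∃! m, (σ, m) ∈ G := by
    obtain ⟨m, hm⟩ := exists_mem σ
    obtain ⟨k, hk⟩ := exists_mem σ⁻¹
    have hmk : m * k = 1 := h.snd_eq_one_of_fst_eq_one _ (mul_mem hm hk) (mul_inv_cancel σ)
    refine ⟨m, hm, fun m' hm' => ?_⟩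
    have hkm' : k * m' = 1 := h.snd_eq_one_of_fst_eq_one _ (mul_mem hk hm') (inv_mul_cancel σ)
    exact (left_inv_eq_right_inv hmk hkm').symm
  obtain ⟨φ, hφ⟩ := exists_monoidHom_of_existsUnique existsUnique
  exact ⟨φ, fun i j => (hφ _ _).1 (swap_mem i j)⟩

omit h in
/-- The homomorphism from the symmetric group that sends each transposition `swap i j` to
`T i j`. -/
noncomputable def ofPerm [Finite α] (h : IsTranspositionSystem T) : Equiv.Perm α →* M :=
  h.exists_monoidHom.choose

lemma ofPerm_swap [Finite α] (i j : α) : h.ofPerm (Equiv.swap i j) = T i j :=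
  h.exists_monoidHom.choose_spec i j

end IsTranspositionSystem

end TranspositionSystems

/-! ### Products of replacements -/

section TransformationSystems

lemma semiconjBy_noncommProd {α M : Type*} [Monoid M] {s : Finset α} {f g : α → M}
    (hf : (s : Set α).Pairwise (Function.onFun Commute f))
    (hg : (s : Set α).Pairwise (Function.onFun Commute g)) {y : M}
    (h : ∀ i ∈ s, SemiconjBy y (f i) (g i)) :
    SemiconjBy y (s.noncommProd f hf) (s.noncommProd g hg) := by
  classical
  induction s using Finset.induction_on with
  | empty => exact SemiconjBy.one_right y
  | insert a s ha ih =>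
    rw [Finset.noncommProd_insert_of_notMem _ _ _ _ ha,
      Finset.noncommProd_insert_of_notMem _ _ _ _ ha]
    exact (h a (Finset.mem_insert_self a s)).mul_right
      (ih _ _ fun i hi => h i (Finset.mem_insert_of_mem hi))

lemma update_comp_idem {α : Type*} [DecidableEq α] {m : α → α} (hm : ∀ i, m (m i) = m i)
    {i j : α} (hij : i ≠ j) (hj : m j = j) (k : α) :
    (Function.update id i j ∘ m) ((Function.update id i j ∘ m) k) =
      (Function.update id i j ∘ m) k := by
  simp only [Function.comp_apply]
  by_cases hk : m k = i
  · rw [hk, Function.update_self, hj, Function.update_of_ne hij.symm, id]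
  · rw [Function.update_of_ne hk, id, hm, Function.update_of_ne hk, id]

variable {α M : Type*} [DecidableEq α] [Monoid M]

/-- A family `T i j`, `R i j` of elements of a monoid that satisfies the relations between the
transpositions `[i,j]` and the replacements `[i|j]`, where `T i i = R i i = 1`. In each law the
indices may coincide except as stated. -/
structure IsTransformationSystem (T R : α → α → M) : Prop extends IsTranspositionSystem T where
  repl_self (i : α) : R i i = 1
  conj_repl (a b c d : α) : T a b * R c d * T a b = R (Equiv.swap a b c) (Equiv.swap a b d)
  repl_mul_transp (i j : α) : R i j * T i j = R i j
  repl_absorb {i k : α} (j : α) (hik : i ≠ k) : R i j * R i k = R i k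
  repl_chain {j k : α} (i : α) (hjk : j ≠ k) : R i j * R j k = T i j * R j k
  repl_comm {i j k l : α} (hik : i ≠ k) (hil : i ≠ l) (hkj : k ≠ j) :
    R i j * R k l = R k l * R i j
  repl_merge (i j k : α) : R i j * R k i = R k j * R i j

namespace IsTransformationSystem

variable {T R : α → α → M} (h : IsTransformationSystem T R)
include h

lemma repl_eq_transp_mul (i j : α) : R j i = T i j * R i j := by
  have conj := h.conj_repl i j i j
  rwa [mul_assoc, h.repl_mul_transp, Equiv.swap_apply_left, Equiv.swap_apply_right, eq_comm]
    at conj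

lemma ofPerm_mul_repl [Finite α] (σ : Equiv.Perm α) (i j : α) :
    h.ofPerm σ * R i j = R (σ i) (σ j) * h.ofPerm σ := by
  induction σ using Equiv.Perm.swap_induction_on generalizing i j with
  | one => simp
  | swap_mul σ a b _ ih =>
    rw [map_mul, h.ofPerm_swap, mul_assoc, ih, ← mul_assoc, ← mul_assoc, Equiv.Perm.mul_apply,
      Equiv.Perm.mul_apply, ← h.conj_repl, mul_assoc _ (T a b) (T a b), h.mul_self, mul_one]

lemma repl_mul_ofPerm [Finite α] (σ : Equiv.Perm α) (i j : α) :
    R i j * h.ofPerm σ = h.ofPerm σ * R (σ⁻¹ i) (σ⁻¹ j) := by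
  rw [h.ofPerm_mul_repl, ← Equiv.Perm.mul_apply, ← Equiv.Perm.mul_apply, mul_inv_cancel,
    Equiv.Perm.one_apply, Equiv.Perm.one_apply]

lemma commute_repl_apply {m : α → α} (hm : ∀ i, m (m i) = m i) (i j : α) :
    Commute (R i (m i)) (R j (m j)) := by
  by_cases hi : m i = i
  · rw [hi, h.repl_self]
    exact Commute.one_left _
  by_cases hj : m j = j
  · rw [hj, h.repl_self]
    exact Commute.one_right _
  by_cases hij : i = j
  · rw [hij]
  · exact h.repl_comm hij (fun e => hi (e ▸ hm j)) fun e => hj (e ▸ hm i)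

lemma pairwise_commute_repl {m : α → α} (hm : ∀ i, m (m i) = m i) (s : Set α) :
    s.Pairwise (Function.onFun Commute fun i => R i (m i)) :=
  fun i _ j _ _ => h.commute_repl_apply hm i j

variable [Fintype α]

omit h in
/-- The product of the replacements `R i (m i)`, in any order, for an idempotent map `m`. -/
def collapse (h : IsTransformationSystem T R) (m : α → α) (hm : ∀ i, m (m i) = m i) : M :=
  Finset.univ.noncommProd (fun i => R i (m i)) (h.pairwise_commute_repl hm _)

lemma collapse_id : h.collapse id (fun _ => rfl) = 1 := by
  refine Finset.noncommProd_eq_pow_card _ _ _ 1 (fun i _ => h.repl_self i) |>.trans ?_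
  rw [one_pow]

lemma collapse_eq_repl_mul_erase {m : α → α} (hm : ∀ i, m (m i) = m i) (i : α) :
    h.collapse m hm = R i (m i) * (Finset.univ.erase i).noncommProd (fun j => R j (m j))
      (h.pairwise_commute_repl hm _) :=
  (Finset.mul_noncommProd_erase _ (Finset.mem_univ i) _ _ _).symm

lemma repl_apply_mul_collapse {m : α → α} (hm : ∀ i, m (m i) = m i) {i : α} (hi : m i ≠ i) :
    R i (m i) * h.collapse m hm = h.collapse m hm := by
  rw [h.collapse_eq_repl_mul_erase hm i, ← mul_assoc, h.repl_absorb _ hi.symm]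

lemma repl_mul_collapse_of_ne {m : α → α} (hm : ∀ i, m (m i) = m i) {i : α} (hi : m i ≠ i)
    (j : α) : R i j * h.collapse m hm = h.collapse m hm := by
  rw [← h.repl_apply_mul_collapse hm hi, ← mul_assoc, h.repl_absorb j hi.symm]

lemma repl_mul_collapse_eq_transp_mul {m : α → α} (hm : ∀ i, m (m i) = m i) (i : α) {j : α}
    (hj : m j ≠ j) : R i j * h.collapse m hm = T i j * h.collapse m hm := by
  rw [← h.repl_apply_mul_collapse hm hj, ← mul_assoc, ← mul_assoc, h.repl_chain i hj.symm]

lemma transp_mul_collapse {m : α → α} (hm : ∀ i, m (m i) = m i) {i j : α} (hi : m i ≠ i)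
    (hj : m j ≠ j) : T i j * h.collapse m hm = h.collapse m hm := by
  rw [← h.repl_mul_collapse_eq_transp_mul hm i hj, h.repl_mul_collapse_of_ne hm hi]

lemma ofPerm_mul_collapse {m : α → α} (hm : ∀ i, m (m i) = m i) {σ : Equiv.Perm α}
    (hσ : ∀ i, σ (m i) = m i) : h.ofPerm σ * h.collapse m hm = h.collapse m hm := by
  have moved {i : α} (hi : σ i ≠ i) : m i ≠ i := fun e => hi (by rw [← e, hσ])
  have mapsTo (i : α) : m (σ i) ≠ σ i ↔ m i ≠ i := by
    refine not_congr ⟨fun e => ?_, fun e => ?_⟩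
    · have : σ i = i := σ.injective (by rw [← e, hσ])
      rwa [this] at e
    · rw [← e, hσ, hm]
  have absorb (τ : Equiv.Perm {i // m i ≠ i}) :
      h.ofPerm (Equiv.Perm.ofSubtype τ) * h.collapse m hm = h.collapse m hm := by
    induction τ using Equiv.Perm.swap_induction_on with
    | one => simp
    | swap_mul τ i j _ ih =>
      rw [map_mul, map_mul, mul_assoc, ih, Equiv.Perm.ofSubtype_swap_eq, h.ofPerm_swap,
        h.transp_mul_collapse hm i.2 j.2]
  rw [← Equiv.Perm.ofSubtype_subtypePerm mapsTo fun i => moved, absorb]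

lemma repl_mul_collapse {m : α → α} (hm : ∀ i, m (m i) = m i) {i j : α} (hij : i ≠ j)
    (hi : m i = i) (hj : m j = j) :
    R i j * h.collapse m hm =
      h.collapse (Function.update id i j ∘ m) (update_comp_idem hm hij hj) := by
  have hm' := update_comp_idem hm hij hj
  set m' := Function.update id i j ∘ m with m'_eq
  have m'_i : m' i = j := by rw [m'_eq, Function.comp_apply, hi, Function.update_self]
  have semiconj (k : α) (hk : k ∈ Finset.univ.erase i) :
      SemiconjBy (R i j) (R k (m k)) (R k (m' k)) := by
    have hki : k ≠ i := Finset.ne_of_mem_erase hk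
    by_cases hmk : m k = i
    · rw [m'_eq, Function.comp_apply, hmk, Function.update_self]
      exact h.repl_merge i j k
    rw [m'_eq, Function.comp_apply, Function.update_of_ne hmk, id]
    by_cases hkj : k = j
    · rw [hkj, hj, h.repl_self]
      exact SemiconjBy.one_right _
    · exact h.repl_comm hki.symm (Ne.symm hmk) hkj
  rw [h.collapse_eq_repl_mul_erase hm i, hi, h.repl_self, one_mul,
    (semiconjBy_noncommProd _ (h.pairwise_commute_repl hm' _) semiconj).eq,
    h.collapse_eq_repl_mul_erase hm' i, m'_i]
  refine (Finset.noncommProd_commute _ _ _ _ fun k _ => ?_).eq.symm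
  rw [← m'_i]
  exact h.commute_repl_apply hm' i k

end IsTransformationSystem

end TransformationSystems

/-! ### Full transformation monoids -/

section FullTransformationMonoid

section BlockMin

variable {α : Type*} [LinearOrder α]

/-- `m` sends every element of each of its fibres to the least element of that fibre; this is the
canonical choice of an idempotent map with a given kernel. -/
structure IsBlockMin (m : α → α) : Prop where
  idem (i : α) : m (m i) = m i
  le (i : α) : m i ≤ i

lemma isBlockMin_id : IsBlockMin (id : α → α) := ⟨fun _ => rfl, le_refl⟩

lemma IsBlockMin.eq_of_ker_eq {m m' : α → α} (hm : IsBlockMin m) (hm' : IsBlockMin m')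
    (hker : ∀ i j, m i = m j ↔ m' i = m' j) : m = m' := by
  funext i
  apply le_antisymm
  · rw [(hker _ _).2 (hm'.idem i).symm]
    exact hm.le _
  · rw [(hker _ _).1 (hm.idem i).symm]
    exact hm'.le _

lemma exists_isBlockMin [Finite α] (f : α → α) :
    ∃ m, IsBlockMin m ∧ ∀ i j, m i = m j ↔ f i = f j := by
  classical
  cases nonempty_fintype α
  let fibre (i : α) : Finset α := Finset.univ.filter fun j => f j = f i
  have fibre_nonempty (i : α) : (fibre i).Nonempty := ⟨i, by simp [fibre]⟩
  let m (i : α) : α := (fibre i).min' (fibre_nonempty i)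
  have f_m (i : α) : f (m i) = f i := by
    simpa [fibre] using (fibre i).min'_mem (fibre_nonempty i)
  have m_eq {i j : α} (hij : f i = f j) : m i = m j := by simp only [m, fibre, hij]
  refine ⟨m, ⟨fun i => m_eq (f_m i), fun i => Finset.min'_le _ _ (by simp [fibre])⟩, fun i j =>
    ⟨fun hij => ?_, m_eq⟩⟩
  rw [← f_m i, hij, f_m j]

lemma exists_perm_comp_isBlockMin [Finite α] (f : α → α) :
    ∃ (σ : Equiv.Perm α) (m : α → α), IsBlockMin m ∧ f = σ ∘ m := by
  cases nonempty_fintype α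
  obtain ⟨m, hm, ker_m⟩ := exists_isBlockMin f
  have injOn : Set.InjOn f (Set.range m) := by
    rintro _ ⟨i, rfl⟩ _ ⟨j, rfl⟩ hij
    rwa [← ker_m, hm.idem, hm.idem] at hij
  obtain ⟨g, hg⟩ := Set.MapsTo.exists_equiv_extend_of_card_eq (t := Finset.univ)
    Finset.card_univ.symm (fun i _ => Finset.mem_univ (f i)) injOn
  refine ⟨g.trans (Equiv.subtypeUnivEquiv Finset.mem_univ), m, hm, funext fun i => ?_⟩
  rw [← (ker_m _ _).1 (hm.idem i)]
  exact (hg _ ⟨i, rfl⟩).symm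

lemma IsBlockMin.update_comp [DecidableEq α] {m : α → α} (hm : IsBlockMin m) {i j : α}
    (hij : j < i) (hj : m j = j) : IsBlockMin (Function.update id i j ∘ m) where
  idem := update_comp_idem hm.idem hij.ne' hj
  le k := by
    by_cases hk : m k = i
    · rw [Function.comp_apply, hk, Function.update_self]
      exact hij.le.trans (hk ▸ hm.le k)
    · rw [Function.comp_apply, Function.update_of_ne hk]
      exact hm.le k

end BlockMin

variable {α M : Type*} [DecidableEq α] [Monoid M]

lemma idempotent_mem_of_update_mem [Finite α] {G : Submonoid (Function.End α)}
    (update_mem : ∀ i j, Function.update id i j ∈ G) {m : α → α} (hm : ∀ i, m (m i) = m i) :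
    m ∈ G := by
  cases nonempty_fintype α
  suffices partial_mem : ∀ s : Finset α, (fun i => if i ∈ s then m i else i) ∈ G by
    simpa using partial_mem Finset.univ
  intro s
  induction s using Finset.induction_on with
  | empty =>
    simp only [Finset.notMem_empty, if_false]
    exact one_mem G
  | insert a s _ ih =>
    have insert_eq_comp : (fun i => if i ∈ insert a s then m i else i) =
        Function.update id a (m a) ∘ fun i => if i ∈ s then m i else i := by
      grind [Function.update_apply]
    rw [insert_eq_comp]
    exact mul_mem (update_mem a (m a)) ih

lemma eq_top_of_swap_mem_of_update_mem [Finite α] {G : Submonoid (Function.End α)}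
    (swap_mem : ∀ i j, ⇑(Equiv.swap i j) ∈ G) (update_mem : ∀ i j, Function.update id i j ∈ G) :
    G = ⊤ := by
  have perm_mem (σ : Equiv.Perm α) : ⇑σ ∈ G := by
    induction σ using Equiv.Perm.swap_induction_on with
    | one => exact one_mem G
    | swap_mul σ i j _ ih => exact mul_mem (swap_mem i j) ih
  refine eq_top_iff.2 fun f _ => ?_
  let order : LinearOrder α := IsWellOrder.linearOrder WellOrderingRel
  obtain ⟨σ, m, hm, rfl⟩ := exists_perm_comp_isBlockMin f
  exact mul_mem (perm_mem σ) (idempotent_mem_of_update_mem update_mem hm.idem)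

namespace IsTransformationSystem

variable {T R : α → α → M}

section NormalForm

variable [LinearOrder α] [Fintype α]

/-- `p` is the normal form in `M` of the self-map `f`. -/
def Represents (h : IsTransformationSystem T R) (f : α → α) (p : M) : Prop :=
  ∃ (σ : Equiv.Perm α) (m : α → α) (hm : IsBlockMin m),
    f = σ ∘ m ∧ p = h.ofPerm σ * h.collapse m hm.idem

variable (h : IsTransformationSystem T R)
include h

lemma represents_collapse {m : α → α} (hm : IsBlockMin m) :
    h.Represents m (h.collapse m hm.idem) := ⟨1, m, hm, rfl, by rw [map_one, one_mul]⟩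

lemma represents_id : h.Represents id 1 :=
  h.collapse_id ▸ h.represents_collapse isBlockMin_id

variable {h}

lemma Represents.unique {f : α → α} {p p' : M} (hp : h.Represents f p)
    (hp' : h.Represents f p') : p = p' := by
  obtain ⟨σ, m, hm, rfl, rfl⟩ := hp
  obtain ⟨σ', m', hm', hf, rfl⟩ := hp'
  obtain rfl : m = m' := hm.eq_of_ker_eq hm' fun i j => by
    rw [← σ.injective.eq_iff, ← σ'.injective.eq_iff (a := m' i)]
    exact Eq.congr (congrFun hf i) (congrFun hf j)
  have fixes (i : α) : (σ⁻¹ * σ') (m i) = m i := by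
    rw [Equiv.Perm.mul_apply, Equiv.Perm.inv_eq_iff_eq]
    exact (congrFun hf i).symm
  calc h.ofPerm σ * h.collapse m hm.idem
      = h.ofPerm σ * (h.ofPerm (σ⁻¹ * σ') * h.collapse m hm.idem) := by
        rw [h.ofPerm_mul_collapse hm.idem fixes]
    _ = h.ofPerm σ' * h.collapse m hm.idem := by
        rw [← mul_assoc, ← map_mul, mul_inv_cancel_left]

lemma Represents.ofPerm_mul {f : α → α} {p : M} (hp : h.Represents f p) (τ : Equiv.Perm α) :
    h.Represents (τ ∘ f) (h.ofPerm τ * p) := by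
  obtain ⟨σ, m, hm, rfl, rfl⟩ := hp
  exact ⟨τ * σ, m, hm, rfl, by rw [map_mul, mul_assoc]⟩

lemma Represents.transp_mul {f : α → α} {p : M} (hp : h.Represents f p) (i j : α) :
    h.Represents (Equiv.swap i j ∘ f) (T i j * p) :=
  h.ofPerm_swap i j ▸ hp.ofPerm_mul (Equiv.swap i j)

variable (h) in
lemma represents_repl_mul_collapse {m : α → α} (hm : IsBlockMin m) (i j : α) :
    h.Represents (Function.update id i j ∘ m) (R i j * h.collapse m hm.idem) := by
  have ne_of_moved {k : α} (hk : m k ≠ k) (l : α) : m l ≠ k := fun e => hk (e ▸ hm.idem l)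
  by_cases hij : i = j
  · rw [hij, h.repl_self, one_mul,
      show Function.update id j j = id from Function.update_eq_self j _]
    exact h.represents_collapse hm
  by_cases hi : m i = i; swap
  · convert h.represents_collapse hm using 1
    · exact funext fun k => Function.update_of_ne (ne_of_moved hi k) _ _
    · exact h.repl_mul_collapse_of_ne hm.idem hi j
  by_cases hj : m j = j; swap
  · convert (h.represents_collapse hm).transp_mul i j using 1
    · funext k
      grind [Function.update_apply]
    · exact h.repl_mul_collapse_eq_transp_mul hm.idem i hj
  have merge {i j : α} (hij : j < i) (hi : m i = i) (hj : m j = j) :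
      h.Represents (Function.update id i j ∘ m) (R i j * h.collapse m hm.idem) :=
    h.repl_mul_collapse hm.idem hij.ne' hi hj ▸ h.represents_collapse (hm.update_comp hij hj)
  rcases lt_or_gt_of_ne hij with hlt | hlt
  · convert (merge hlt hj hi).transp_mul i j using 1
    · funext k
      grind [Function.update_apply]
    · rw [← mul_assoc, h.symm i j, ← h.repl_eq_transp_mul]
  · exact merge hlt hi hj

lemma Represents.repl_mul {f : α → α} {p : M} (hp : h.Represents f p) (i j : α) :
    h.Represents (Function.update id i j ∘ f) (R i j * p) := by
  obtain ⟨σ, m, hm, rfl, rfl⟩ := hp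
  convert (h.represents_repl_mul_collapse hm (σ⁻¹ i) (σ⁻¹ j)).ofPerm_mul σ using 1
  · funext k
    grind [Function.update_apply, Equiv.Perm.inv_eq_iff_eq]
  · rw [← mul_assoc, ← mul_assoc, h.repl_mul_ofPerm]

end NormalForm

theorem exists_monoidHom_end [Finite α] (h : IsTransformationSystem T R) :
    ∃ φ : Function.End α →* M,
      (∀ i j, φ ⇑(Equiv.swap i j) = T i j) ∧ ∀ i j, φ (Function.update id i j) = R i j := by
  cases nonempty_fintype α
  let order : LinearOrder α := IsWellOrder.linearOrder WellOrderingRel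
  let G : Submonoid (Function.End α × M) := Submonoid.closure
    {p | ∃ i j, p = (⇑(Equiv.swap i j), T i j) ∨ p = (Function.update id i j, R i j)}
  have swap_mem (i j : α) : ((⇑(Equiv.swap i j), T i j) : Function.End α × M) ∈ G :=
    Submonoid.subset_closure ⟨i, j, .inl rfl⟩
  have update_mem (i j : α) : ((Function.update id i j, R i j) : Function.End α × M) ∈ G :=
    Submonoid.subset_closure ⟨i, j, .inr rfl⟩
  have exists_mem (f : Function.End α) : ∃ p, (f, p) ∈ G := by
    have map_eq_top : G.map (MonoidHom.fst (Function.End α) M) = ⊤ :=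
      eq_top_of_swap_mem_of_update_mem (fun i j => ⟨_, swap_mem i j, rfl⟩)
        fun i j => ⟨_, update_mem i j, rfl⟩
    have mem_map : f ∈ G.map (MonoidHom.fst (Function.End α) M) :=
      map_eq_top ▸ Submonoid.mem_top f
    obtain ⟨⟨_, p⟩, hp, rfl⟩ := mem_map
    exact ⟨p, hp⟩
  have represents {q : Function.End α × M} (hq : q ∈ G) : h.Represents q.1 q.2 := by
    induction hq using Submonoid.closure_induction_left with
    | one => exact h.represents_id
    | mul_left g hg q _ ih =>
      obtain ⟨i, j, rfl | rfl⟩ := hg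
      · exact ih.transp_mul i j
      · exact ih.repl_mul i j
  obtain ⟨φ, hφ⟩ := exists_monoidHom_of_existsUnique fun f => by
    obtain ⟨p, hp⟩ := exists_mem f
    exact ⟨p, hp, fun p' hp' => (represents hp').unique (represents hp)⟩
  exact ⟨φ, fun i j => (hφ _ _).1 (swap_mem i j), fun i j => (hφ _ _).1 (update_mem i j)⟩

end IsTransformationSystem

end FullTransformationMonoid

/-! ### The monoid presented by the relations -/

section Presentation

variable {n : ℕ}

/-- The class of `s_ij` in the monoid presented by the relations, with the convention
`s_ii = 1`. -/
def transpClass (i j : Fin n) : (conGen (Rel n)).Quotient :=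
  if h : i ≠ j then ↑(t i j h) else 1

/-- The class of `s^i_j` in the monoid presented by the relations, with the convention
`s^i_i = 1`. -/
def replClass (i j : Fin n) : (conGen (Rel n)).Quotient :=
  if h : i ≠ j then ↑(r i j h) else 1

lemma transpClass_self (i : Fin n) : transpClass i i = 1 := dif_neg (not_not_intro rfl)

lemma replClass_self (i : Fin n) : replClass i i = 1 := dif_neg (not_not_intro rfl)

lemma transpClass_of_ne {i j : Fin n} (h : i ≠ j) : transpClass i j = ↑(t i j h) := dif_pos h

lemma replClass_of_ne {i j : Fin n} (h : i ≠ j) : replClass i j = ↑(r i j h) := dif_pos h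

lemma Rel.coe_eq {v w : FreeMonoid (Gen n)} (h : Rel n v w) :
    (v : (conGen (Rel n)).Quotient) = w :=
  (Con.eq _).2 (ConGen.Rel.of _ _ h)

lemma transpClass_symm (i j : Fin n) : transpClass i j = transpClass j i := by
  by_cases h : i = j
  · rw [h]
  · rw [transpClass_of_ne h, transpClass_of_ne (Ne.symm h)]
    exact (Rel.transp_symm i j h).coe_eq

lemma transpClass_mul_self (i j : Fin n) : transpClass i j * transpClass i j = 1 := by
  by_cases h : i = j
  · rw [h, transpClass_self, one_mul]
  · rw [transpClass_of_ne h]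
    exact (Rel.transp_sq i j h).coe_eq

lemma transpClass_conj_transpClass (a b c d : Fin n) :
    transpClass a b * transpClass c d * transpClass a b =
      transpClass (Equiv.swap a b c) (Equiv.swap a b d) := by
  by_cases hab : a = b
  · simp [hab, transpClass_self]
  by_cases hcd : c = d
  · simp [hcd, transpClass_self, transpClass_mul_self]
  have chain {i j k : Fin n} (hij : i ≠ j) (hik : i ≠ k) (hjk : j ≠ k) :
      transpClass i j * transpClass j k * transpClass i j = transpClass i k := by
    rw [transpClass_of_ne hij, transpClass_of_ne hik, transpClass_of_ne hjk]
    exact (Rel.transp_conj i j k hij hik hjk).coe_eq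
  have comm (hca : c ≠ a) (hcb : c ≠ b) (hda : d ≠ a) (hdb : d ≠ b) :
      transpClass a b * transpClass c d = transpClass c d * transpClass a b := by
    rw [transpClass_of_ne hab, transpClass_of_ne hcd]
    exact (Rel.transp_comm a b c d hab hca.symm hda.symm hcb.symm hdb.symm hcd).coe_eq
  grind [mul_assoc, mul_one, one_mul, transpClass_symm, transpClass_mul_self]

lemma transpClass_conj_replClass (a b c d : Fin n) :
    transpClass a b * replClass c d * transpClass a b =
      replClass (Equiv.swap a b c) (Equiv.swap a b d) := by
  by_cases hab : a = b
  · simp [hab, transpClass_self]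
  by_cases hcd : c = d
  · simp [hcd, replClass_self, transpClass_mul_self]
  have conj_both : transpClass c d * replClass c d * transpClass c d = replClass d c := by
    rw [transpClass_symm, transpClass_of_ne (Ne.symm hcd), replClass_of_ne hcd,
      replClass_of_ne (Ne.symm hcd)]
    exact (Rel.conj_ij d c (Ne.symm hcd)).coe_eq
  have conj_source {e : Fin n} (hce : c ≠ e) (hde : d ≠ e) :
      transpClass c e * replClass c d * transpClass c e = replClass e d := by
    rw [transpClass_of_ne hce, replClass_of_ne hcd, replClass_of_ne hde.symm]
    exact (Rel.conj_jk d c e (Ne.symm hcd) hde hce).coe_eq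
  have conj_target {e : Fin n} (hce : c ≠ e) (hde : d ≠ e) :
      transpClass e d * replClass c d * transpClass e d = replClass c e := by
    rw [transpClass_of_ne hde.symm, replClass_of_ne hcd, replClass_of_ne hce]
    exact (Rel.conj_ki d c e (Ne.symm hcd) hde hce).coe_eq
  have conj_disjoint (hca : c ≠ a) (hcb : c ≠ b) (hda : d ≠ a) (hdb : d ≠ b) :
      transpClass a b * replClass c d * transpClass a b = replClass c d := by
    rw [transpClass_of_ne hab, replClass_of_ne hcd]
    exact (Rel.conj_kl d c a b (Ne.symm hcd) hda hdb hca hcb hab).coe_eq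
  grind [transpClass_symm]

lemma replClass_mul_transpClass (i j : Fin n) :
    replClass i j * transpClass i j = replClass i j := by
  by_cases hij : i = j
  · rw [hij, transpClass_self, mul_one]
  · rw [transpClass_symm, replClass_of_ne hij, transpClass_of_ne (Ne.symm hij)]
    exact (Rel.repl_transp j i (Ne.symm hij)).coe_eq

lemma replClass_absorb {i k : Fin n} (j : Fin n) (hik : i ≠ k) :
    replClass i j * replClass i k = replClass i k := by
  by_cases hij : i = j
  · rw [← hij, replClass_self, one_mul]
  by_cases hjk : j = k
  · rw [hjk, replClass_of_ne hik]
    exact (Rel.repl_idem k i hik.symm).coe_eq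
  · rw [replClass_of_ne hij, replClass_of_ne hik]
    exact (Rel.repl_absorb j i k (Ne.symm hij) hjk hik).coe_eq

lemma replClass_eq_transpClass_mul (i j : Fin n) :
    replClass i j = transpClass i j * replClass j i := by
  conv_rhs => rw [← replClass_mul_transpClass, ← mul_assoc, transpClass_symm j i,
    transpClass_conj_replClass, Equiv.swap_apply_left, Equiv.swap_apply_right]

lemma replClass_chain {j k : Fin n} (i : Fin n) (hjk : j ≠ k) :
    replClass i j * replClass j k = transpClass i j * replClass j k := by
  by_cases hij : i = j
  · rw [hij, replClass_self, transpClass_self]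
  by_cases hik : i = k
  · subst hik
    rw [← replClass_eq_transpClass_mul, replClass_of_ne hij, replClass_of_ne hjk]
    exact (Rel.repl_back j i hjk).coe_eq
  have chain : replClass i j * replClass j k = replClass i k * transpClass i j := by
    rw [transpClass_symm, replClass_of_ne hij, replClass_of_ne hjk, replClass_of_ne hik,
      transpClass_of_ne (Ne.symm hij)]
    exact (Rel.repl_chain j i k (Ne.symm hij) hjk hik).coe_eq
  have conj := transpClass_conj_replClass i j j k
  rw [Equiv.swap_apply_right, Equiv.swap_apply_of_ne_of_ne (Ne.symm hik) hjk.symm] at conj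
  rw [chain, ← conj, mul_assoc, transpClass_mul_self, mul_one]

lemma replClass_comm {i j k l : Fin n} (hik : i ≠ k) (hil : i ≠ l) (hkj : k ≠ j) :
    replClass i j * replClass k l = replClass k l * replClass i j := by
  by_cases hij : i = j
  · rw [← hij, replClass_self, one_mul, mul_one]
  by_cases hkl : k = l
  · rw [← hkl, replClass_self, one_mul, mul_one]
  rw [replClass_of_ne hij, replClass_of_ne hkl]
  by_cases hjl : j = l
  · subst hjl
    exact (Rel.repl_same j i k (Ne.symm hij) hkj.symm hik).coe_eq
  · exact (Rel.repl_comm j i k l (Ne.symm hij) hkj.symm hjl hik hil hkl).coe_eq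

lemma replClass_merge (i j k : Fin n) :
    replClass i j * replClass k i = replClass k j * replClass i j := by
  by_cases hki : k = i
  · subst hki
    by_cases hkj : k = j
    · rw [hkj]
    · rw [replClass_self, mul_one, replClass_absorb j hkj]
  by_cases hij : i = j
  · rw [hij, replClass_self, one_mul, mul_one]
  by_cases hkj : k = j
  · subst hkj
    rw [replClass_self, one_mul, replClass_of_ne hij, replClass_of_ne hki]
    exact (Rel.repl_back k i hki).coe_eq
  rw [replClass_of_ne hij, replClass_of_ne hki, replClass_of_ne hkj]
  exact (Rel.repl_same_chain j i k (Ne.symm hij) (Ne.symm hkj) (Ne.symm hki)).coe_eq.symm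

lemma isTransformationSystem_class :
    IsTransformationSystem (transpClass (n := n)) replClass where
  self := transpClass_self
  mul_self := transpClass_mul_self
  conj := transpClass_conj_transpClass
  repl_self := replClass_self
  conj_repl := transpClass_conj_replClass
  repl_mul_transp := replClass_mul_transpClass
  repl_absorb := replClass_absorb
  repl_chain := replClass_chain
  repl_comm := replClass_comm
  repl_merge := replClass_merge

lemma wordMap_transp {i j : Fin n} (h : i ≠ j) : wordMap n (t i j h) = ⇑(Equiv.swap i j) := rfl

lemma wordMap_repl {i j : Fin n} (h : i ≠ j) : wordMap n (r i j h) = Function.update id i j := rfl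

lemma wordMap_eq_of_rel {v w : FreeMonoid (Gen n)} (h : Rel n v w) :
    wordMap n v = wordMap n w := by
  have mul_apply (f g : Function.End (Fin n)) (i : Fin n) : (f * g) i = f (g i) := rfl
  have one_apply (i : Fin n) : (1 : Function.End (Fin n)) i = i := rfl
  funext i
  cases h <;>
    simp only [map_mul, map_one, one_apply, wordMap_transp, wordMap_repl,
      Function.update_apply, id, Equiv.swap_apply_def] <;>
    grind

lemma wordMap_surjective (n : ℕ) : Function.Surjective (wordMap n) := by
  refine MonoidHom.mrange_eq_top.1 (eq_top_of_swap_mem_of_update_mem (fun i j => ?_) fun i j => ?_)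
  · by_cases hij : i = j
    · rw [hij, Equiv.swap_self]
      exact one_mem (MonoidHom.mrange (wordMap n))
    · exact ⟨t i j hij, wordMap_transp hij⟩
  · by_cases hij : i = j
    · rw [hij, show Function.update id j j = id from Function.update_eq_self j _]
      exact one_mem (MonoidHom.mrange (wordMap n))
    · exact ⟨r i j hij, wordMap_repl hij⟩

theorem isPresentation_rel (n : ℕ) : IsPresentation n (Rel n) := by
  refine ⟨wordMap_surjective n, fun v w => ⟨fun h => ?_, fun h => ?_⟩⟩
  · have le_ker : conGen (Rel n) ≤ Con.ker (wordMap n) :=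
      Con.conGen_le.2 fun _ _ h => wordMap_eq_of_rel h
    exact le_ker h
  · obtain ⟨φ, φ_swap, φ_update⟩ := (isTransformationSystem_class (n := n)).exists_monoidHom_end
    have φ_comp_wordMap : φ.comp (wordMap n) = (conGen (Rel n)).mk' := by
      refine FreeMonoid.hom_eq fun g => ?_
      cases g with
      | repl i j hij => exact (φ_update i j).trans (replClass_of_ne hij)
      | transp i j hij => exact (φ_swap i j).trans (transpClass_of_ne hij)
    rw [← Con.eq, ← Con.coe_mk', ← φ_comp_wordMap, MonoidHom.comp_apply, MonoidHom.comp_apply, h]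

end Presentation

open FirstOrder.Language

/-! ### Finiteness and positivity -/

section Axioms

variable {n : ℕ}

instance : Finite (Gen n) := by
  let code : Gen n → Bool × Fin n × Fin n
    | .repl i j _ => (true, i, j)
    | .transp i j _ => (false, i, j)
  refine Finite.of_injective code ?_
  rintro (⟨i, j, h⟩ | ⟨i, j, h⟩) (⟨i', j', h'⟩ | ⟨i', j', h'⟩) e <;> simp_all [code]

lemma finite_booleanAxioms : (booleanAxioms n).Finite := by
  unfold booleanAxioms
  exact Set.toFinite _

lemma finite_endoAxioms : (endoAxioms n).Finite := by
  have endoAxioms_eq_iUnion : endoAxioms n = ⋃ g : Gen n,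
      {(tSubst g (tMeet (x 0) (x 1)), tMeet (tSubst g (x 0)) (tSubst g (x 1))),
        (tSubst g (tJoin (x 0) (x 1)), tJoin (tSubst g (x 0)) (tSubst g (x 1))),
        (tSubst g tZero, tZero), (tSubst g tOne, tOne)} := by
    ext e
    simp [endoAxioms]
  rw [endoAxioms_eq_iUnion]
  exact Set.finite_iUnion fun g => Set.toFinite _

lemma length_le_three_of_rel {v w : FreeMonoid (Gen n)} (h : Rel n v w) :
    v.toList.length ≤ 3 ∧ w.toList.length ≤ 3 := by
  cases h <;> simp [t, r]

lemma finite_relAxioms_rel : (relAxioms (Rel n)).Finite := by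
  have finite_words : {l : List (Gen n) | l.length ≤ 3}.Finite := List.finite_length_le _ _
  refine ((finite_words.prod finite_words).image fun p =>
    ((tWord (FreeMonoid.ofList p.1) (x 0), tWord (FreeMonoid.ofList p.2) (x 0)) : Eqn n)).subset ?_
  rintro _ ⟨v, w, h, rfl⟩
  exact ⟨(v.toList, w.toList), length_le_three_of_rel h, rfl⟩

lemma finite_Ax : (Ax n).Finite :=
  (finite_booleanAxioms.union finite_endoAxioms).union finite_relAxioms_rel

lemma Positive.tWord {a : Tm n} (ha : Positive a) (w : FreeMonoid (Gen n)) :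
    Positive (tWord w a) := by
  unfold SubstAlg.tWord
  induction w.toList with
  | nil => exact ha
  | cons g l ih => exact ih.subst g

lemma positive_of_mem_endoAxioms {e : Eqn n} (he : e ∈ endoAxioms n) :
    Positive e.1 ∧ Positive e.2 := by
  have pos_x (i : ℕ) : Positive (x i : Tm n) := .var i
  obtain ⟨g, rfl | rfl | rfl | rfl⟩ := he
  · exact ⟨((pos_x 0).meet (pos_x 1)).subst g, ((pos_x 0).subst g).meet ((pos_x 1).subst g)⟩
  · exact ⟨((pos_x 0).join (pos_x 1)).subst g, ((pos_x 0).subst g).join ((pos_x 1).subst g)⟩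
  · exact ⟨Positive.zero.subst g, .zero⟩
  · exact ⟨Positive.one.subst g, .one⟩

lemma positive_of_mem_relAxioms {R : FreeMonoid (Gen n) → FreeMonoid (Gen n) → Prop} {e : Eqn n}
    (he : e ∈ relAxioms R) : Positive e.1 ∧ Positive e.2 := by
  obtain ⟨v, w, -, rfl⟩ := he
  exact ⟨(Positive.var 0).tWord v, (Positive.var 0).tWord w⟩

end Axioms

/-! ### Varieties -/

section Varieties

variable {n : ℕ} {E : Set (Eqn n)}

lemma H_Mod_subset : H (Mod.{u} E) ⊆ Mod E := by
  rintro A ⟨B, hB, f, hf⟩ e he v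
  obtain ⟨v', rfl⟩ : ∃ v', f ∘ v' = v := hf.comp_left v
  rw [HomClass.realize_term, HomClass.realize_term, hB e he v']

lemma S_Mod_subset : S (Mod.{u} E) ⊆ Mod E := by
  rintro A ⟨B, hB, ⟨f⟩⟩ e he v
  apply f.injective
  rw [← HomClass.realize_term, ← HomClass.realize_term, hB e he]

/-- The projections of a direct product of algebras, as homomorphisms. -/
def prodAlgProj {I : Type u} (F : I → Alg.{u} n) (i : I) :
    (prodAlg F).carrier →[lang n] (F i).carrier where
  toFun a := a i
  map_fun' _ _ := rfl
  map_rel' r _ := nomatch r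

lemma prodAlg_mem_Mod {I : Type u} {F : I → Alg.{u} n} (hF : ∀ i, F i ∈ Mod E) :
    prodAlg F ∈ Mod E := by
  intro e he v
  funext i
  change prodAlgProj F i _ = prodAlgProj F i _
  rw [← HomClass.realize_term, ← HomClass.realize_term, hF i e he]

lemma P_Mod_subset : P (Mod.{u} E) ⊆ Mod E := by
  rintro A ⟨I, F, hF, ⟨f⟩⟩
  exact S_Mod_subset ⟨_, prodAlg_mem_Mod hF, ⟨f.toEmbedding⟩⟩

theorem isVariety_Mod (E : Set (Eqn n)) : IsVariety (Mod.{u} E) :=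
  ⟨H_Mod_subset, S_Mod_subset, P_Mod_subset⟩

lemma S_mono {K L : Set (Alg.{u} n)} (h : K ⊆ L) : S K ⊆ S L :=
  fun _ ⟨B, hB, f⟩ => ⟨B, h hB, f⟩

lemma P_mono {K L : Set (Alg.{u} n)} (h : K ⊆ L) : P K ⊆ P L :=
  fun _ ⟨I, F, hF, f⟩ => ⟨I, F, fun i => h (hF i), f⟩

lemma S_P_subset_Mod {K : Set (Alg.{u} n)} (hK : K ⊆ Mod E) : S (P K) ⊆ Mod E :=
  (S_mono ((P_mono hK).trans P_Mod_subset)).trans S_Mod_subset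

lemma subset_S (K : Set (Alg.{u} n)) : K ⊆ S K :=
  fun A hA => ⟨A, hA, ⟨Embedding.refl (lang n) A.carrier⟩⟩

lemma mem_S_P_of_separating {K : Set (Alg.{u} n)} {A : Alg.{u} n}
    (h : ∀ a b : A.carrier, a ≠ b → ∃ B ∈ K, ∃ f : A.carrier →[lang n] B.carrier, f a ≠ f b) :
    A ∈ S (P K) := by
  choose B hB f hf using h
  let I : Type u := {p : A.carrier × A.carrier // p.1 ≠ p.2}
  refine ⟨prodAlg fun p : I => B _ _ p.2,
    ⟨I, _, fun p => hB _ _ p.2, ⟨FirstOrder.Language.Equiv.refl (lang n) _⟩⟩, ⟨?_⟩⟩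
  exact
    { toFun := fun a p => f _ _ p.2 a
      inj' := fun a b hab => by_contra fun hne => hf a b hne (congrFun hab ⟨(a, b), hne⟩)
      map_fun' := fun F a => funext fun p => (f _ _ p.2).map_fun F a
      map_rel' := fun r _ => nomatch r }

end Varieties

/-! ### Operations of an algebra -/

section Operations

variable {n : ℕ}

namespace Alg

variable (A B : Alg.{u} n)

/-- The operation `a · b`. -/
def meet (a b : A.carrier) : A.carrier :=
  Structure.funMap (L := lang n) (Op.meet : Op n 2) ![a, b]

/-- The operation `-a`. -/
def compl (a : A.carrier) : A.carrier :=
  Structure.funMap (L := lang n) (Op.compl : Op n 1) ![a]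

/-- The substitution operations `s^i_j` and `s_ij`, as self-maps of the algebra. -/
def subst (g : Gen n) : Function.End A.carrier :=
  fun a => Structure.funMap (L := lang n) (Op.subst g : Op n 1) ![a]

/-- The derived operation `a + b`. -/
def join (a b : A.carrier) : A.carrier := A.compl (A.meet (A.compl a) (A.compl b))

/-- The operations `s_1 s_2 ⋯ s_m` for words `s_1 s_2 ⋯ s_m` in the substitution symbols. -/
def act : FreeMonoid (Gen n) →* Function.End A.carrier := FreeMonoid.lift A.subst

/-- The monoid of the self-maps of an algebra that preserve `·` and `-`. -/
def booleanEnd : Submonoid (Function.End A.carrier) where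
  carrier := {s | (∀ a b, s (A.meet a b) = A.meet (s a) (s b)) ∧
    ∀ a, s (A.compl a) = A.compl (s a)}
  one_mem' := ⟨fun _ _ => rfl, fun _ => rfl⟩
  mul_mem' {s _} hs hs' :=
    ⟨fun a b => (congrArg s (hs'.1 a b)).trans (hs.1 _ _),
      fun a => (congrArg s (hs'.2 a)).trans (hs.2 _)⟩

/-- `A` is a Boolean algebra with respect to `·` and `-`. -/
def IsBoolean : Prop :=
  ∃ _ : BooleanAlgebra A.carrier, (∀ a b, A.meet a b = a ⊓ b) ∧ ∀ a, A.compl a = aᶜ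

variable {A B}

/-- A map that preserves all the operations, as a homomorphism. -/
def homOfPreserves (f : A.carrier → B.carrier)
    (meet : ∀ a b, f (A.meet a b) = B.meet (f a) (f b))
    (compl : ∀ a, f (A.compl a) = B.compl (f a))
    (subst : ∀ g a, f (A.subst g a) = B.subst g (f a)) : A.carrier →[lang n] B.carrier where
  toFun := f
  map_fun' F a := by
    cases F with
    | meet =>
      obtain ⟨b, c, rfl⟩ : ∃ b c, a = ![b, c] := ⟨a 0, a 1, by ext i; fin_cases i <;> rfl⟩
      exact (meet b c).trans (congrArg (Structure.funMap (L := lang n) (Op.meet : Op n 2))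
        (funext fun i => by fin_cases i <;> rfl))
    | compl =>
      obtain ⟨b, rfl⟩ : ∃ b, a = ![b] := ⟨a 0, by ext i; fin_cases i; rfl⟩
      exact (compl b).trans (congrArg (Structure.funMap (L := lang n) (Op.compl : Op n 1))
        (funext fun i => by fin_cases i; rfl))
    | subst g =>
      obtain ⟨b, rfl⟩ : ∃ b, a = ![b] := ⟨a 0, by ext i; fin_cases i; rfl⟩
      exact (subst g b).trans (congrArg (Structure.funMap (L := lang n) (Op.subst g : Op n 1))
        (funext fun i => by fin_cases i; rfl))
  map_rel' r _ := nomatch r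

end Alg

variable {A : Alg.{u} n} (v : ℕ → A.carrier)

lemma realize_x (i : ℕ) : (x i : Tm n).realize v = v i := rfl

lemma realize_tMeet (a b : Tm n) :
    (tMeet a b).realize v = A.meet (a.realize v) (b.realize v) :=
  congrArg (Structure.funMap (L := lang n) (Op.meet : Op n 2))
    (funext fun i => by fin_cases i <;> rfl)

lemma realize_tCompl (a : Tm n) : (tCompl a).realize v = A.compl (a.realize v) :=
  congrArg (Structure.funMap (L := lang n) (Op.compl : Op n 1))
    (funext fun i => by fin_cases i; rfl)

lemma realize_tSubst (g : Gen n) (a : Tm n) :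
    (tSubst g a).realize v = A.subst g (a.realize v) :=
  congrArg (Structure.funMap (L := lang n) (Op.subst g : Op n 1))
    (funext fun i => by fin_cases i; rfl)

lemma realize_tJoin (a b : Tm n) :
    (tJoin a b).realize v = A.join (a.realize v) (b.realize v) := by
  rw [tJoin, realize_tCompl, realize_tMeet, realize_tCompl, realize_tCompl, Alg.join]

lemma realize_tZero : (tZero : Tm n).realize v = A.meet (v 0) (A.compl (v 0)) := by
  rw [tZero, realize_tMeet, realize_tCompl, realize_x]

lemma realize_tOne : (tOne : Tm n).realize v = A.join (v 0) (A.compl (v 0)) := by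
  rw [tOne, realize_tJoin, realize_tCompl, realize_x]

lemma realize_tWord (w : FreeMonoid (Gen n)) (a : Tm n) :
    (tWord w a).realize v = A.act w (a.realize v) := by
  induction w using FreeMonoid.inductionOn' with
  | one => rfl
  | of_mul g w ih =>
    rw [map_mul]
    exact (realize_tSubst v g (tWord w a)).trans (congrArg (A.subst g) ih)

end Operations

/-! ### Models of the axioms -/

section Models

variable {n : ℕ} {A : Alg.{u} n}

lemma mem_Mod_union {E₁ E₂ : Set (Eqn n)} : A ∈ Mod (E₁ ∪ E₂) ↔ A ∈ Mod E₁ ∧ A ∈ Mod E₂ :=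
  Set.union_subset_iff (u := {e | A.Satisfies e})

lemma isBoolean_of_mem_Mod (hA : A ∈ Mod (booleanAxioms n)) : A.IsBoolean := by
  simp only [Mod, booleanAxioms, Alg.Satisfies, Set.mem_ofPred_eq, Set.mem_insert_iff,
    Set.mem_singleton_iff, forall_eq_or_imp, forall_eq, realize_tMeet, realize_tJoin, realize_tZero,
    realize_tOne, realize_x] at hA
  obtain ⟨meet_comm, join_comm, meet_assoc, join_assoc, meet_join, join_meet, -, join_distrib,
    join_zero, meet_one⟩ := hA
  let val (a b c : A.carrier) : ℕ → A.carrier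
    | 0 => a
    | 1 => b
    | _ => c
  let o := Classical.arbitrary A.carrier
  let max : Max A.carrier := ⟨A.join⟩
  let min : Min A.carrier := ⟨A.meet⟩
  let lattice : Lattice A.carrier := Lattice.mk' (fun a b => join_comm (val a b b))
    (fun a b c => join_assoc (val a b c)) (fun a b => meet_comm (val a b b))
    (fun a b c => meet_assoc (val a b c)) (fun a b => join_meet (val a b b))
    (fun a b => meet_join (val a b b))
  have meet_compl_le (a b : A.carrier) : A.meet a (A.compl a) ≤ b :=
    sup_eq_left.1 (join_zero (val a b b))
  have le_join_compl (a b : A.carrier) : b ≤ A.join a (A.compl a) :=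
    inf_eq_left.1 (meet_one (val a b b))
  exact
    ⟨{ lattice with
        le_sup_inf a b c := (join_distrib (val a b c)).ge
        compl := A.compl
        top := A.join o (A.compl o)
        bot := A.meet o (A.compl o)
        inf_compl_le_bot a := meet_compl_le a _
        top_le_sup_compl a := le_join_compl a _
        le_top := le_join_compl o
        bot_le := meet_compl_le o }, fun _ _ => rfl, fun _ => rfl⟩

lemma Alg.join_eq_sup [BooleanAlgebra A.carrier] (meet_eq : ∀ a b : A.carrier, A.meet a b = a ⊓ b)
    (compl_eq : ∀ a : A.carrier, A.compl a = aᶜ) (a b : A.carrier) : A.join a b = a ⊔ b := by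
  rw [Alg.join, meet_eq, compl_eq, compl_eq, compl_eq, compl_inf, compl_compl, compl_compl]

lemma mem_Mod_booleanAxioms_iff : A ∈ Mod (booleanAxioms n) ↔ A.IsBoolean := by
  refine ⟨isBoolean_of_mem_Mod, fun ⟨_, meet_eq, compl_eq⟩ => ?_⟩
  have join_eq := Alg.join_eq_sup meet_eq compl_eq
  simp only [Mod, booleanAxioms, Alg.Satisfies, Set.mem_ofPred_eq, Set.mem_insert_iff,
    Set.mem_singleton_iff, forall_eq_or_imp, forall_eq, realize_tMeet, realize_tJoin, realize_tZero,
    realize_tOne, realize_x, meet_eq, join_eq, compl_eq]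
  exact ⟨fun _ => inf_comm _ _, fun _ => sup_comm _ _, fun _ => inf_assoc _ _ _,
    fun _ => sup_assoc _ _ _, fun _ => inf_sup_self, fun _ => sup_inf_self,
    fun _ => inf_sup_left _ _ _, fun _ => sup_inf_left _ _ _,
    fun _ => by rw [inf_compl_eq_bot, sup_bot_eq], fun _ => by rw [sup_compl_eq_top, inf_top_eq]⟩

lemma subst_mem_booleanEnd_of_mem_Mod (hA : A.IsBoolean) (h : A ∈ Mod (endoAxioms n)) (g : Gen n) :
    A.subst g ∈ A.booleanEnd := by
  obtain ⟨_, meet_eq, compl_eq⟩ := hA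
  have join_eq := Alg.join_eq_sup meet_eq compl_eq
  have meet := h _ ⟨g, .inl rfl⟩
  have join := h _ ⟨g, .inr (.inl rfl)⟩
  have zero := h _ ⟨g, .inr (.inr (.inl rfl))⟩
  have one := h _ ⟨g, .inr (.inr (.inr rfl))⟩
  simp only [Alg.Satisfies, realize_tSubst, realize_tMeet, realize_tJoin, realize_tZero,
    realize_tOne, realize_x, meet_eq, join_eq, compl_eq, inf_compl_eq_bot, sup_compl_eq_top]
    at meet join zero one
  let val (a b : A.carrier) : ℕ → A.carrier
    | 0 => a
    | _ => b
  have bot : A.subst g ⊥ = ⊥ := zero (val ⊥ ⊥)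
  have top : A.subst g ⊤ = ⊤ := one (val ⊥ ⊥)
  have inf (a b : A.carrier) : A.subst g (a ⊓ b) = A.subst g a ⊓ A.subst g b := meet (val a b)
  have sup (a b : A.carrier) : A.subst g (a ⊔ b) = A.subst g a ⊔ A.subst g b := join (val a b)
  refine ⟨fun a b => by rw [meet_eq, meet_eq, inf], fun a => ?_⟩
  have isCompl : IsCompl (A.subst g a) (A.subst g aᶜ) :=
    .of_eq (by rw [← inf, inf_compl_eq_bot, bot]) (by rw [← sup, sup_compl_eq_top, top])
  rw [compl_eq, compl_eq, isCompl.compl_eq]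

lemma mem_Mod_endoAxioms_iff (hA : A.IsBoolean) :
    A ∈ Mod (endoAxioms n) ↔ ∀ g, A.subst g ∈ A.booleanEnd := by
  refine ⟨subst_mem_booleanEnd_of_mem_Mod hA, fun h => ?_⟩
  obtain ⟨_, meet_eq, compl_eq⟩ := hA
  have join_eq := Alg.join_eq_sup meet_eq compl_eq
  have compl (g : Gen n) (a : A.carrier) : A.subst g aᶜ = (A.subst g a)ᶜ := by
    simpa only [compl_eq] using (h g).2 a
  have inf (g : Gen n) (a b : A.carrier) : A.subst g (a ⊓ b) = A.subst g a ⊓ A.subst g b := by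
    simpa only [meet_eq] using (h g).1 a b
  have bot (g : Gen n) : A.subst g ⊥ = ⊥ := by
    rw [← inf_compl_eq_bot (a := (⊥ : A.carrier)), inf, compl, inf_compl_eq_bot, inf_compl_eq_bot]
  rintro _ ⟨g, rfl | rfl | rfl | rfl⟩ v <;>
    simp only [realize_tSubst, realize_tMeet, realize_tJoin, realize_tZero, realize_tOne, realize_x,
      meet_eq, join_eq, compl_eq, inf_compl_eq_bot, sup_compl_eq_top]
  · exact inf g _ _
  · rw [← compl_compl (v 0 ⊔ v 1), compl_sup, compl, inf, compl, compl, compl_inf, compl_compl,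
      compl_compl]
  · exact bot g
  · rw [← compl_bot, compl, bot]

lemma mem_Mod_relAxioms_iff {R : FreeMonoid (Gen n) → FreeMonoid (Gen n) → Prop} :
    A ∈ Mod (relAxioms R) ↔ ∀ v w, R v w → A.act v = A.act w := by
  refine ⟨fun h v w hvw => funext fun a => ?_, ?_⟩
  · simpa only [realize_tWord, realize_x] using h _ ⟨v, w, hvw, rfl⟩ fun _ => a
  · rintro h _ ⟨v, w, hvw, rfl⟩ val
    rw [realize_tWord, realize_tWord, h v w hvw]

lemma IsPresentation.exists_comp_wordMap {R : FreeMonoid (Gen n) → FreeMonoid (Gen n) → Prop}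
    (hR : IsPresentation n R) {N : Type*} [Monoid N] {η : FreeMonoid (Gen n) →* N}
    (hη : ∀ v w, R v w → η v = η w) :
    ∃ ρ : Function.End (Fin n) →* N, ρ.comp (wordMap n) = η := by
  have ker_le : Con.ker (wordMap n) ≤ Con.ker η := fun v w h =>
    (Con.conGen_le.2 hη : conGen R ≤ Con.ker η) ((hR.2 v w).2 h)
  let e := Con.quotientKerEquivOfSurjective (wordMap n) hR.1
  refine ⟨((Con.ker (wordMap n)).lift η ker_le).comp e.symm.toMonoidHom, MonoidHom.ext fun w => ?_⟩
  have e_symm : e.symm (wordMap n w) = w := e.symm_apply_eq.2 rfl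
  rw [MonoidHom.comp_apply, MonoidHom.comp_apply, MulEquiv.toMonoidHom_eq_coe, MonoidHom.coe_coe,
    e_symm, Con.lift_coe]

/-- `ρ` is an action of the monoid of all self-maps of `n` on the Boolean algebra `A` by
endomorphisms, such that the substitution operations of `A` are the actions of `[i|j]` and
`[i,j]`. -/
structure IsSubstAction (A : Alg.{u} n) (ρ : Function.End (Fin n) →* Function.End A.carrier) :
    Prop where
  apply_toEnd (g : Gen n) : ρ g.toEnd = A.subst g
  mem_booleanEnd (f : Function.End (Fin n)) : ρ f ∈ A.booleanEnd

lemma IsSubstAction.comp_wordMap {ρ : Function.End (Fin n) →* Function.End A.carrier}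
    (hρ : IsSubstAction A ρ) : ρ.comp (wordMap n) = A.act :=
  FreeMonoid.hom_eq hρ.apply_toEnd

lemma mem_Mod_iff_exists_isSubstAction {R : FreeMonoid (Gen n) → FreeMonoid (Gen n) → Prop}
    (hR : IsPresentation n R) :
    A ∈ Mod (booleanAxioms n ∪ endoAxioms n ∪ relAxioms R) ↔
      A.IsBoolean ∧ ∃ ρ, IsSubstAction A ρ := by
  rw [mem_Mod_union, mem_Mod_union, mem_Mod_booleanAxioms_iff, mem_Mod_relAxioms_iff, and_assoc]
  refine and_congr_right fun hA => ?_
  rw [mem_Mod_endoAxioms_iff hA]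
  refine ⟨fun ⟨subst_mem, act_eq⟩ => ?_, fun ⟨ρ, hρ⟩ => ⟨fun g => ?_, fun v w hvw => ?_⟩⟩
  · obtain ⟨ρ, hρ⟩ := hR.exists_comp_wordMap act_eq
    refine ⟨ρ, fun g => DFunLike.congr_fun hρ (FreeMonoid.of g), fun f => ?_⟩
    obtain ⟨w, rfl⟩ := hR.1 f
    rw [← MonoidHom.comp_apply, hρ]
    induction w using FreeMonoid.inductionOn' with
    | one => exact one_mem _
    | of_mul g w ih =>
      rw [map_mul]
      exact mul_mem (subst_mem g) ih
  · rw [← hρ.apply_toEnd]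
    exact hρ.mem_booleanEnd _
  · rw [← hρ.comp_wordMap, MonoidHom.comp_apply, MonoidHom.comp_apply,
      (hR.2 v w).1 (ConGen.Rel.of _ _ hvw)]

end Models

/-! ### Representation by set algebras -/

section Representation

variable {n : ℕ}

/-- The action of the self-maps of `n` on the full set algebra with base `U`,
`ρ f X = {q | q ∘ f ∈ X}`. -/
def fullAlgAction (n : ℕ) (U : Type u) :
    Function.End (Fin n) →* Function.End (fullAlg n U).carrier where
  toFun f := Set.preimage fun q : Fin n → U => q ∘ f
  map_one' := rfl
  map_mul' _ _ := rfl

lemma isBoolean_fullAlg (U : Type u) : (fullAlg n U).IsBoolean :=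
  ⟨inferInstanceAs (BooleanAlgebra (Set (Fin n → U))), fun _ _ => rfl, fun _ => rfl⟩

lemma isSubstAction_fullAlgAction (U : Type u) :
    IsSubstAction (fullAlg n U) (fullAlgAction n U) where
  apply_toEnd _ := rfl
  mem_booleanEnd _ := ⟨fun _ _ => Set.preimage_inter, fun _ => Set.preimage_compl⟩

lemma exists_boundedLatticeHom_of_not_le {B : Type*} [DistribLattice B] [BoundedOrder B] {a b : B}
    (h : ¬ a ≤ b) : ∃ F : BoundedLatticeHom B Prop, F a ∧ ¬ F b := by
  obtain ⟨J, J_prime, b_le, disj⟩ := DistribLattice.prime_ideal_of_disjoint_filter_ideal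
    (F := Order.PFilter.principal a) (I := Order.Ideal.principal b) <|
      Set.disjoint_left.2 fun c hac hcb =>
        h ((Order.PFilter.mem_principal.1 hac).trans (Order.Ideal.mem_principal.1 hcb))
  have inf_mem (c d : B) : c ⊓ d ∈ J ↔ c ∈ J ∨ d ∈ J :=
    ⟨J_prime.mem_or_mem, Or.rec (J.lower inf_le_left) (J.lower inf_le_right)⟩
  exact
    ⟨{ toFun c := c ∉ J
       map_sup' c d := by simp [Order.Ideal.sup_mem_iff, imp_iff_not_or]
       map_inf' c d := by simp [inf_mem, not_or]
       map_top' := eq_true J_prime.toIsProper.top_notMem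
       map_bot' := eq_false (not_not_intro J.bot_mem) },
      Set.disjoint_left.1 disj (Order.PFilter.mem_principal.2 le_rfl),
      not_not_intro (b_le (Order.Ideal.mem_principal.2 le_rfl))⟩

variable {A : Alg.{u} n} {ρ : Function.End (Fin n) →* Function.End A.carrier}

lemma IsSubstAction.apply_mul_toEnd (hρ : IsSubstAction A ρ) (f : Function.End (Fin n))
    (g : Gen n) : ρ (f * g.toEnd) = ρ f * A.subst g := by
  rw [map_mul, hρ.apply_toEnd]

/-- The representation of `A` on the base `n` given by an ultrafilter `F`: it sends `b` to the set
of all self-maps `q` of `n` whose action takes `b` into `F`. -/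
def IsSubstAction.representation (hρ : IsSubstAction A ρ) (F : A.carrier → Prop)
    (map_meet : ∀ a b, F (A.meet a b) ↔ F a ∧ F b) (map_compl : ∀ a, F (A.compl a) ↔ ¬ F a) :
    A.carrier →[lang n] (fullAlg n (ULift.{u} (Fin n))).carrier :=
  Alg.homOfPreserves (fun b => {q : Fin n → ULift.{u} (Fin n) | F (ρ (ULift.down ∘ q) b)})
    (fun a b => Set.ext fun _ =>
      (iff_of_eq (congrArg F ((hρ.mem_booleanEnd _).1 a b))).trans (map_meet _ _))
    (fun a => Set.ext fun _ =>
      (iff_of_eq (congrArg F ((hρ.mem_booleanEnd _).2 a))).trans (map_compl _))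
    fun g a => Set.ext fun q =>
      iff_of_eq (congrArg F (congrFun (hρ.apply_mul_toEnd (ULift.down ∘ q) g) a).symm)

lemma IsSubstAction.exists_hom_ne (hA : A.IsBoolean) (hρ : IsSubstAction A ρ) {a b : A.carrier}
    (hab : a ≠ b) :
    ∃ f : A.carrier →[lang n] (fullAlg n (ULift.{u} (Fin n))).carrier, f a ≠ f b := by
  obtain ⟨_, meet_eq, compl_eq⟩ := hA
  wlog h : ¬ a ≤ b generalizing a b
  · obtain ⟨f, hf⟩ := this hab.symm fun hba => hab (le_antisymm (not_not.1 h) hba)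
    exact ⟨f, hf.symm⟩
  obtain ⟨F, ha, hb⟩ := exists_boundedLatticeHom_of_not_le h
  let f := hρ.representation F (fun c d => by rw [meet_eq, map_inf]; rfl)
    fun c => by rw [compl_eq, map_compl']; rfl
  let evalUp : (fullAlg n (ULift.{u} (Fin n))).carrier → Prop :=
    fun X : Set (Fin n → ULift.{u} (Fin n)) => ULift.up ∈ X
  have evalUp_f (c : A.carrier) : evalUp (f c) = F c := congrArg F (congrFun (map_one ρ) c)
  exact ⟨f, fun e => hb (by rwa [← evalUp_f b, ← e, evalUp_f a])⟩

theorem RSA_eq_Mod_of_isPresentation {R : FreeMonoid (Gen n) → FreeMonoid (Gen n) → Prop}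
    (hR : IsPresentation n R) :
    RSA.{u} n = Mod (booleanAxioms n ∪ endoAxioms n ∪ relAxioms R) := by
  have fullAlg_mem (U : Type u) :
      fullAlg n U ∈ Mod (booleanAxioms n ∪ endoAxioms n ∪ relAxioms R) :=
    (mem_Mod_iff_exists_isSubstAction hR).2
      ⟨isBoolean_fullAlg U, fullAlgAction n U, isSubstAction_fullAlgAction U⟩
  refine (S_P_subset_Mod ?_).antisymm fun A hA => ?_
  · refine (S_mono ?_).trans S_Mod_subset
    rintro _ ⟨U, rfl⟩
    exact fullAlg_mem U
  · obtain ⟨hbool, ρ, hρ⟩ := (mem_Mod_iff_exists_isSubstAction hR).1 hA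
    exact mem_S_P_of_separating fun a b hab =>
      ⟨_, subset_S _ ⟨ULift.{u} (Fin n), rfl⟩, hρ.exists_hom_ne hbool hab⟩

end Representation

end SubstAlg

theorem mainTheorem1 (n : ℕ) (hn : 2 ≤ n) :
    (SubstAlg.Ax n).Finite ∧
    (∀ e ∈ SubstAlg.endoAxioms n ∪ SubstAlg.relAxioms (SubstAlg.Rel n),
      SubstAlg.Positive e.1 ∧ SubstAlg.Positive e.2) ∧
    SubstAlg.IsPresentation n (SubstAlg.Rel n) ∧
    SubstAlg.RSA.{u} n = SubstAlg.SA.{u} n ∧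
    SubstAlg.IsVariety (SubstAlg.RSA.{u} n) ∧
    SubstAlg.IsFinitelyBased (SubstAlg.RSA.{u} n) := by
  have hRSA : SubstAlg.RSA.{u} n = SubstAlg.SA n :=
    SubstAlg.RSA_eq_Mod_of_isPresentation (SubstAlg.isPresentation_rel n)
  refine ⟨SubstAlg.finite_Ax, fun e he => ?_, SubstAlg.isPresentation_rel n, hRSA, ?_,
    SubstAlg.Ax n, SubstAlg.finite_Ax, hRSA⟩
  · exact he.elim SubstAlg.positive_of_mem_endoAxioms SubstAlg.positive_of_mem_relAxioms
  · rw [hRSA]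
    exact SubstAlg.isVariety_Mod (SubstAlg.Ax n)
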